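/- Let $(\Omega,\mathcal F,\mathbb P)$ be a probability space and $\mathcal G\subseteq\mathcal F$ a sub-$\sigma$-algebra. Let $L^1(\mathcal F)$ be the space of $\mathbb P$-integrable real random variables, modulo $\mathbb P$-a.s. equality and ordered by the $\mathbb P$-a.s. order, and let $L^1(\mathcal G)\subseteq L^1(\mathcal F)$ be the subspace of (classes of) $\mathcal G$-measurable random variables, with the induced order. For a sequence in an ordered space, $x_m\downarrow x$ means that $(x_m)$ is decreasing with infimum $x$. Let $h:L^1(\mathcal F)\to L^1(\mathcal G)$ be - monotone: $X\ge Y$ implies $h(X)\ge h(Y)$; - sublinear: $h(X+Y)\le h(X)+h(Y)$ and $h(\alpha X)=\alpha h(X)$ for all $X,Y\in L^1(\mathcal F)$ and real $\alpha\ge 0$; - $\mathcal G$-normalized: $h(Z)=Z$ for all $Z\in L^1(\mathcal G)$; - continuous from above: $h(X_m)\downarrow h(X)$ whenever $X_m\downarrow X$ in $L^1(\mathcal F)$ and $|X_m|\le Y$ for all $m\in\mathbb N$ and some $Y\in L^1(\mathcal F)$. Then there exists a convex set $\mathcal Q$ of probability measures on $(\Omega,\mathcal F)$ such that $Q\ll\mathbb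 P$ and $Q|_{\mathcal G}=\mathbb P|_{\mathcal G}$ for every $Q\in\mathcal Q$, every $X\in L^1(\mathcal F)$ is $Q$-integrable for every $Q\in\mathcal Q$, and $$h(X)=\sup_{Q\in\mathcal Q}\mathbb E^{Q}[X\mid\mathcal G]\qquad\text{for all }X\in L^1(\mathcal F),$$ where the supremum is the least upper bound in $L^1(\mathcal G)$ for the $\mathbb P$-a.s. order. -/

import Mathlib

open MeasureTheory
open scoped NNReal ENNReal

/-- The space `L¹(𝓕)` of `P`-integrable real random variables modulo `P`-a.s. equality, with the
`P`-a.s. order. -/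
abbrev LOne {Ω : Type*} [F : MeasurableSpace Ω] (P : Measure Ω) : Type _ :=
  Lp ℝ 1 P

/-- The space `L¹(𝓖)`, seen as the subspace of those classes in `L¹(𝓕)` that contain a
`𝓖`-measurable random variable. It carries the order induced by `L¹(𝓕)`. -/
noncomputable abbrev LOneSub {Ω : Type*} (G : MeasurableSpace Ω) [F : MeasurableSpace Ω] (P : Measure Ω) :
    Submodule ℝ (LOne P) :=
  lpMeas ℝ ℝ G 1 P

/-- Subadditive and positively homogeneous. -/
def IsSublinear {V W : Type*} [AddCommGroup V] [Module ℝ V] [AddCommGroup W] [Module ℝ W] [LE W]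
    (h : V → W) : Prop :=
  (∀ x y : V, h (x + y) ≤ h x + h y) ∧ ∀ (α : ℝ) (x : V), 0 ≤ α → h (α • x) = α • h x

/-- `x m ↓ a`: the sequence is decreasing, with infimum `a`. -/
def DecreasesTo {V : Type*} [Preorder V] (x : ℕ → V) (a : V) : Prop :=
  Antitone x ∧ IsGLB (Set.range x) a

/-- `h(w) = w` for all `w` in the subspace `W`. -/
def IsNormalizedOn {V : Type*} [AddCommGroup V] [Module ℝ V] (W : Submodule ℝ V) (h : V → W) :
    Prop :=
  ∀ w : W, h (w : V) = w

/-- Continuity from above along order bounded decreasing sequences. -/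
def ContinuousFromAbove {V W : Type*} [AddCommGroup V] [Lattice V] [Preorder W] (h : V → W) :
    Prop :=
  ∀ (x : ℕ → V) (a y : V), (∀ m, |x m| ≤ y) → DecreasesTo x a →
    DecreasesTo (fun m => h (x m)) (h a)

/-- The probability measures `Q` on `𝓕` with `Q ≪ P` and `Q|𝓖 = P|𝓖`. -/
def probAgreeing {Ω : Type*} {G F : MeasurableSpace Ω} (hG : G ≤ F) (P : Measure Ω) :
    Set (Measure Ω) :=
  {Q | IsProbabilityMeasure Q ∧ Q ≪ P ∧ Q.trim hG = P.trim hG}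

/-- If `Q|𝓖 = P|𝓖`, then `E^Q[X|𝓖]` is `P`-integrable. -/
theorem condExp_memLp_of_mem_probAgreeing {Ω : Type*} {G F : MeasurableSpace Ω} {hG : G ≤ F}
    {P Q : Measure Ω} (hQ : Q ∈ probAgreeing hG P) (X : Ω → ℝ) :
    MemLp (condExp G Q X) 1 P := by
  have hint : Integrable (condExp G Q X) (Q.trim hG) :=
    integrable_condExp.trim hG stronglyMeasurable_condExp
  rw [hQ.2.2] at hint
  exact memLp_one_iff_integrable.2 (integrable_of_integrable_trim hG hint)

/-- The conditional expectation `E^Q[X|𝓖]`, for `Q ≪ P` with `Q|𝓖 = P|𝓖`, as an element of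
`L¹(𝓖)`; as `Q` and `P` agree on `𝓖`, it is determined up to `P`-null sets. -/
noncomputable def condExpIn {Ω : Type*} {G F : MeasurableSpace Ω} {hG : G ≤ F}
    {P Q : Measure Ω} (hQ : Q ∈ probAgreeing hG P) (X : Ω → ℝ) : LOneSub G P :=
  ⟨(condExp_memLp_of_mem_probAgreeing hQ X).toLp (condExp G Q X),
    mem_lpMeas_iff_aestronglyMeasurable.2
      ⟨condExp G Q X, stronglyMeasurable_condExp, MemLp.coeFn_toLp _⟩⟩

/-! Averaging reduces the conditional statement to a scalar one. The functional `X ↦ E^P[h X]` is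
sublinear on `L¹(𝓕)`, so by Hahn–Banach some linear `l` below it touches it at a given `X₀`.
Monotonicity of `h` makes `l` positive; positive functionals on a Banach lattice are bounded, so `l`
is integration against a measure `Q` with bounded density (`exists_measure_integral_eq`).
Normalization forces `Q = P` on `𝓖`.

To recover `E^Q[X|𝓖] ≤ h X`, test on `A ∈ 𝓖`: `l (1_A X) ≤ E^P[h (1_A X)] ≤ E^P[1_A h X]`. The
second inequality is locality (`integral_map_restrictTo_le`), the only place where continuity from
above enters. At `X₀` both sides have the same integral, hence agree a.s., so the supremum is
attained. -/

/-! ### Positive functionals on `L¹` -/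

/-- A positive linear functional on a Banach lattice is bounded. -/
theorem exists_norm_bound_of_nonneg {E : Type*} [NormedAddCommGroup E] [Lattice E] [HasSolidNorm E]
    [IsOrderedAddMonoid E] [NormedSpace ℝ E] [IsOrderedModule ℝ E] [CompleteSpace E]
    (l : E →ₗ[ℝ] ℝ) (hl : ∀ x, 0 ≤ x → 0 ≤ l x) :
    ∃ C : ℝ, 0 ≤ C ∧ ∀ x, |l x| ≤ C * ‖x‖ := by
  have mono : ∀ x y, x ≤ y → l x ≤ l y := fun x y hxy => by
    simpa using hl (y - x) (sub_nonneg.2 hxy)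
  have habs : ∀ x, |l x| ≤ l |x| := fun x =>
    abs_le'.2 ⟨mono _ _ (le_abs_self x), by simpa using mono _ _ (neg_le_abs x)⟩
  by_contra! hc
  -- The factor `4 ^ n` is split between small norm and large value. The sum of the `z n` then
  -- dominates each of them, so `l` of it would exceed every `2 ^ n`.
  have : ∀ n : ℕ, ∃ z : E, 0 ≤ z ∧ ‖z‖ ≤ (1 / 2) ^ n ∧ (2 : ℝ) ^ n ≤ l z := by
    intro n
    obtain ⟨x, hx⟩ := hc (4 ^ n) (by positivity)
    have hx0 : 0 < ‖x‖ := by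
      rw [norm_pos_iff]; rintro rfl; simp at hx
    refine ⟨(2 ^ n * ‖x‖)⁻¹ • |x|, smul_nonneg (by positivity) (abs_nonneg x), ?_, ?_⟩
    · rw [norm_smul, norm_abs_eq_norm, norm_inv, norm_mul, norm_norm, mul_inv, mul_assoc,
        inv_mul_cancel₀ hx0.ne']
      simp
    · rw [map_smul, smul_eq_mul, ← div_eq_inv_mul, le_div_iff₀ (by positivity)]
      calc (2 : ℝ) ^ n * (2 ^ n * ‖x‖) = 4 ^ n * ‖x‖ := by
            rw [← mul_assoc, ← mul_pow]; norm_num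
        _ ≤ l |x| := hx.le.trans (habs x)
  choose z hz0 hz1 hz2 using this
  have hs : Summable z := Summable.of_norm_bounded summable_geometric_two hz1
  obtain ⟨n, hn⟩ := pow_unbounded_of_one_lt (l (∑' n, z n)) (one_lt_two (α := ℝ))
  exact absurd ((hz2 n).trans (mono _ _ (hs.le_tsum n fun m _ => hz0 m))) (not_le.2 hn)

/-- A positive linear functional on `L¹` is the integral against a measure with bounded density. -/
theorem exists_measure_integral_eq {Ω : Type*} [MeasurableSpace Ω] (P : Measure Ω)
    [IsFiniteMeasure P] (l : Lp ℝ 1 P →ₗ[ℝ] ℝ) (hl : ∀ x, 0 ≤ x → 0 ≤ l x) :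
    ∃ (Q : Measure Ω) (C : ℝ≥0∞), C ≠ ∞ ∧ Q ≤ C • P ∧ ∀ X : Lp ℝ 1 P, ∫ ω, X ω ∂Q = l X := by
  have : IsOrderedModule ℝ (Lp ℝ 1 P) := .of_smul_nonneg fun c hc x hx => by
    rw [← Lp.coeFn_nonneg] at hx ⊢
    filter_upwards [hx, Lp.coeFn_smul c x] with ω h1 h2
    rw [h2]; exact mul_nonneg hc h1
  obtain ⟨C, hC0, hC⟩ := exists_norm_bound_of_nonneg l hl
  let L : Lp ℝ 1 P →L[ℝ] ℝ := l.mkContinuous C fun x => by simpa using hC x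
  let ι : ∀ B : Set Ω, MeasurableSet B → Lp ℝ 1 P := fun B hB =>
    indicatorConstLp 1 hB (measure_ne_top P B) 1
  have ι0 : ∀ B hB, 0 ≤ ι B hB := fun B hB => by
    rw [← Lp.coeFn_nonneg]
    filter_upwards [indicatorConstLp_coeFn (p := 1) (hs := hB) (hμs := measure_ne_top P B)
      (c := (1 : ℝ))] with ω h1
    rw [h1]; exact Set.indicator_nonneg (fun _ _ => zero_le_one) _
  have ιnorm : ∀ B hB, ‖ι B hB‖ = P.real B := fun B hB => by
    simp [ι, norm_indicatorConstLp]
  have ιadd : ∀ A B hA hB, Disjoint A B → ∀ hAB, ι (A ∪ B) hAB = ι A hA + ι B hB :=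
    fun A B hA hB hd hAB => indicatorConstLp_disjoint_union hA hB _ _ hd 1
  have ιcongr : ∀ A B hA hB, A = B → ι A hA = ι B hB := by rintro A B hA hB rfl; rfl
  have hsum : ∀ (f : ℕ → Set Ω) (hf : ∀ i, MeasurableSet (f i)), Pairwise (Function.onFun Disjoint f) →
      HasSum (fun i => l (ι (f i) (hf i))) (l (ι (⋃ i, f i) (.iUnion hf))) := by
    intro f hf hd
    rw [hasSum_iff_tendsto_nat_of_nonneg fun i => hl _ (ι0 _ _)]
    have hU : ∀ n, MeasurableSet (⋃ i < n, f i) := fun n =>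
      .iUnion fun i => .iUnion fun _ => hf i
    have key : ∀ n, ∑ i ∈ Finset.range n, l (ι (f i) (hf i)) = l (ι (⋃ i < n, f i) (hU n)) := by
      intro n
      induction n with
      | zero =>
        have : ι (⋃ i < 0, f i) (hU 0) = 0 := by
          rw [← norm_eq_zero, ιnorm]; simp
        rw [Finset.sum_range_zero, this, map_zero]
      | succ n ih =>
        have hdn : Disjoint (⋃ i < n, f i) (f n) := by
          simp only [Set.disjoint_iUnion_left]
          exact fun i hi => hd hi.ne
        rw [Finset.sum_range_succ, ih, ← map_add, ← ιadd _ _ _ _ hdn ((hU n).union (hf n))]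
        congr 1
        exact ιcongr _ _ _ _ (Set.biUnion_lt_succ _ _).symm
    simp_rw [key]
    -- Countable additivity comes from norm continuity: indicators of the partial unions converge in
    -- `L¹`.
    refine (L.continuous.tendsto _).comp ?_
    refine tendsto_indicatorConstLp_set (by simp) ?_
    have h1 : Filter.Tendsto (fun n => P ((⋃ i, f i) \ ⋃ i < n, f i)) Filter.atTop (nhds 0) := by
      have := tendsto_measure_iInter_atTop (μ := P) (s := fun n => (⋃ i, f i) \ ⋃ i < n, f i)
        (fun n => ((MeasurableSet.iUnion hf).diff (hU n)).nullMeasurableSet)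
        (fun m n hmn => Set.sdiff_subset_sdiff_right
          (Set.biUnion_subset_biUnion_left fun i hi => lt_of_lt_of_le hi hmn))
        ⟨0, measure_ne_top _ _⟩
      suffices h0 : ⋂ n, ((⋃ i, f i) \ ⋃ i < n, f i) = ∅ by
        rwa [h0, measure_empty] at this
      rw [Set.eq_empty_iff_forall_notMem]
      intro ω hω
      simp only [Set.mem_iInter, Set.mem_sdiff, Set.mem_iUnion, not_exists] at hω
      obtain ⟨i, hi⟩ := (hω 0).1
      exact (hω (i + 1)).2 i (Nat.lt_succ_self i) hi
    refine h1.congr fun n => ?_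
    have : (⋃ i < n, f i) ⊆ ⋃ i, f i := Set.iUnion₂_subset fun i _ => Set.subset_iUnion f i
    rw [Set.symmDiff_def, Set.sdiff_eq_empty.2 this, Set.empty_union]
  let Q : Measure Ω := Measure.ofMeasurable (fun B hB => ENNReal.ofReal (l (ι B hB)))
    (by
      have : ι ∅ .empty = 0 := by rw [← norm_eq_zero, ιnorm]; simp
      simp [this])
    (fun f hf hd => by
      rw [← ENNReal.ofReal_tsum_of_nonneg (fun i => hl _ (ι0 _ _)) (hsum f hf hd).summable,
        (hsum f hf hd).tsum_eq])
  have hQ : ∀ B hB, Q B = ENNReal.ofReal (l (ι B hB)) := fun B hB =>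
    Measure.ofMeasurable_apply B hB
  have hQP : Q ≤ ENNReal.ofReal C • P := by
    refine Measure.le_iff.2 fun B hB => ?_
    rw [hQ B hB, Measure.smul_apply, smul_eq_mul, ← ofReal_measureReal (μ := P),
      ← ENNReal.ofReal_mul hC0, ← ιnorm B hB]
    exact ENNReal.ofReal_le_ofReal ((le_abs_self _).trans (hC _))
  refine ⟨Q, ENNReal.ofReal C, ENNReal.ofReal_ne_top, hQP, fun X => ?_⟩
  -- `T` rereads a `P`-class as a `Q`-class; its continuity lets the identity pass from indicators
  -- to all of `L¹`.
  let T : Lp ℝ 1 P →L[ℝ] Lp ℝ 1 Q := Lp.LpToLpOfMeasureLeSMul ENNReal.ofReal_ne_top hQP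
  have hT : ∀ X, ∫ ω, T X ω ∂Q = ∫ ω, X ω ∂Q := fun X =>
    integral_congr_ae (Lp.coeFn_LpToLpOfMeasureLeSMul ENNReal.ofReal_ne_top hQP X)
  have hac : Q ≪ P := Measure.absolutelyContinuous_of_le_smul hQP
  have hadd : ∀ X Y, ∫ ω, T (X + Y) ω ∂Q = ∫ ω, T X ω ∂Q + ∫ ω, T Y ω ∂Q := fun X Y => by
    rw [map_add, ← integral_add (L1.integrable_coeFn _) (L1.integrable_coeFn _)]
    exact integral_congr_ae (Lp.coeFn_add _ _)
  rw [← hT]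
  refine Lp.induction ENNReal.one_ne_top (motive := fun X => ∫ ω, T X ω ∂Q = l X)
    (fun c B hB hμB => ?_) (fun f g hf hg _ h1 h2 => ?_) ?_ X
  · have hι : (Lp.simpleFunc.indicatorConst 1 hB hμB.ne c : Lp ℝ 1 P) = c • ι B hB := by
      rw [Lp.simpleFunc.coe_indicatorConst]
      ext
      filter_upwards [indicatorConstLp_coeFn (p := 1) (hs := hB) (hμs := hμB.ne) (c := c),
        Lp.coeFn_smul c (ι B hB), indicatorConstLp_coeFn (p := 1) (hs := hB)
          (hμs := measure_ne_top P B) (c := (1 : ℝ))] with ω h1 h2 h3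
      rw [h1, h2, Pi.smul_apply, h3]
      by_cases hω : ω ∈ B <;> simp [hω]
    rw [hT, Lp.simpleFunc.coe_indicatorConst,
      integral_congr_ae (hac.ae_eq indicatorConstLp_coeFn), ← Lp.simpleFunc.coe_indicatorConst,
      hι, integral_indicator_const _ hB, map_smul, measureReal_def, hQ B hB,
      ENNReal.toReal_ofReal (hl _ (ι0 _ _)), smul_eq_mul, smul_eq_mul, mul_comm]
  · rw [hadd, h1, h2, map_add]
  · exact isClosed_eq (continuous_integral.comp T.continuous) L.continuous

/-! ### Monotone limits and truncation -/

open Filter Topology in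
/-- In `L¹(𝓖)`, integrals converge to `0` along sequences decreasing to `0`. -/
theorem tendsto_integral_of_decreasesTo_zero {Ω : Type*} {G F : MeasurableSpace Ω}
    {P : Measure Ω} {Z : ℕ → LOneSub G P} (hZ : DecreasesTo Z 0) :
    Tendsto (fun n => ∫ ω, (Z n : LOne P) ω ∂P) atTop (𝓝 0) := by
  have hanti : ∀ᵐ ω ∂P, ∀ n, (Z (n + 1) : LOne P) ω ≤ (Z n : LOne P) ω :=
    ae_all_iff.2 fun n => (Lp.coeFn_le _ _).2 (hZ.1 n.le_succ)
  have hnonneg : ∀ᵐ ω ∂P, ∀ n, 0 ≤ (Z n : LOne P) ω :=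
    ae_all_iff.2 fun n => (Lp.coeFn_nonneg _).2 (hZ.2.1 ⟨n, rfl⟩)
  let L : Ω → ℝ := fun ω => ⨅ n, (Z n : LOne P) ω
  have hbdd : ∀ ω, (∀ n, 0 ≤ (Z n : LOne P) ω) →
      BddBelow (Set.range fun n => (Z n : LOne P) ω) := fun ω hω => ⟨0, by
    rintro _ ⟨n, rfl⟩; exact hω n⟩
  have hlim : ∀ᵐ ω ∂P, Tendsto (fun n => (Z n : LOne P) ω) atTop (𝓝 (L ω)) := by
    filter_upwards [hanti, hnonneg] with ω h1 h2
    exact tendsto_atTop_ciInf (antitone_nat_of_succ_le h1) (hbdd ω h2)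
  -- The infimum `0` is taken within `L¹(𝓖)`, so `L` competes as a lower bound only if it is
  -- `𝓖`-measurable.
  have hLm : AEStronglyMeasurable[G] L P := by
    have hm := fun n => lpMeas.aestronglyMeasurable (Z n)
    refine ⟨fun ω => ⨅ n, (hm n).mk _ ω,
      (Measurable.iInf fun n => (hm n).stronglyMeasurable_mk.measurable).stronglyMeasurable, ?_⟩
    filter_upwards [ae_all_iff.2 fun n => (hm n).ae_eq_mk] with ω hω
    exact congrArg iInf (funext hω)
  have hLmF : AEStronglyMeasurable L P :=
    aestronglyMeasurable_of_tendsto_ae atTop (fun n => (Lp.aestronglyMeasurable _)) hlim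
  have hLn : ∀ n, L ≤ᵐ[P] (Z n : LOne P) := fun n => by
    filter_upwards [hnonneg] with ω h2
    exact ciInf_le (hbdd ω h2) n
  have hL0 : 0 ≤ᵐ[P] L := by
    filter_upwards [hnonneg] with ω h2
    exact le_ciInf h2
  have hZ0 : ∀ n, Integrable (Z n : LOne P) P := fun n => L1.integrable_coeFn _
  have hLi : Integrable L P := by
    refine (hZ0 0).mono hLmF ?_
    filter_upwards [hLn 0, hL0] with ω h1 h2
    rw [Real.norm_of_nonneg h2, Real.norm_of_nonneg (h2.trans h1)]
    exact h1
  have hLp : MemLp L 1 P := memLp_one_iff_integrable.2 hLi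
  let Λ : LOneSub G P := ⟨hLp.toLp L, mem_lpMeas_iff_aestronglyMeasurable.2
    (hLm.congr hLp.coeFn_toLp.symm)⟩
  have hΛ : Λ ≤ 0 := hZ.2.2 (by
    rintro _ ⟨n, rfl⟩
    change hLp.toLp L ≤ (Z n : LOne P)
    rw [← Lp.coeFn_le]
    exact hLp.coeFn_toLp.trans_le (hLn n))
  have hLz : L =ᵐ[P] 0 := by
    have h1 : hLp.toLp L ≤ 0 := hΛ
    rw [← Lp.coeFn_le] at h1
    filter_upwards [h1, hLp.coeFn_toLp, Lp.coeFn_zero ℝ 1 P, hL0] with ω h1 h2 h3 h4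
    rw [h2, h3] at h1
    exact le_antisymm h1 h4
  have hI : ∫ ω, L ω ∂P = 0 := integral_eq_zero_of_ae hLz
  rw [← hI]
  refine tendsto_integral_of_dominated_convergence (fun ω => (Z 0 : LOne P) ω)
    (fun n => Lp.aestronglyMeasurable _) (hZ0 0) (fun n => ?_) hlim
  filter_upwards [hanti, hnonneg] with ω h1 h2
  rw [Real.norm_of_nonneg (h2 n)]
  exact antitone_nat_of_succ_le (f := fun n => (Z n : LOne P) ω) h1 (Nat.zero_le n)

/-- The excess of `|X|` over the level `n`. -/
noncomputable def excess {Ω : Type*} [MeasurableSpace Ω] {P : Measure Ω} [IsFiniteMeasure P]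
    (X : LOne P) (n : ℕ) : LOne P :=
  (|X| - Lp.const 1 P (n : ℝ)) ⊔ 0

theorem coeFn_excess {Ω : Type*} [MeasurableSpace Ω] {P : Measure Ω} [IsFiniteMeasure P]
    (X : LOne P) (n : ℕ) : excess X n =ᵐ[P] fun ω => max (|X ω| - n) 0 := by
  filter_upwards [Lp.coeFn_sup (|X| - Lp.const 1 P (n : ℝ)) 0, Lp.coeFn_abs X,
    Lp.coeFn_sub |X| (Lp.const 1 P (n : ℝ)), Lp.coeFn_const (p := 1) (μ := P) (n : ℝ),
    Lp.coeFn_zero ℝ 1 P] with ω h1 h2 h3 h4 h5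
  rw [excess, h1, Pi.sup_apply, h3, Pi.sub_apply, h2, h4, h5]
  rfl

theorem excess_nonneg {Ω : Type*} [MeasurableSpace Ω] {P : Measure Ω} [IsFiniteMeasure P]
    (X : LOne P) (n : ℕ) : 0 ≤ excess X n :=
  le_sup_right

theorem abs_excess_le {Ω : Type*} [MeasurableSpace Ω] {P : Measure Ω} [IsFiniteMeasure P]
    (X : LOne P) (n : ℕ) : |excess X n| ≤ |X| := by
  rw [abs_of_nonneg (excess_nonneg X n), ← Lp.coeFn_le]
  filter_upwards [coeFn_excess X n, Lp.coeFn_abs X] with ω h1 h2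
  rw [h1, h2]
  exact max_le (sub_le_self _ n.cast_nonneg) (abs_nonneg _)

theorem decreasesTo_excess {Ω : Type*} [MeasurableSpace Ω] {P : Measure Ω} [IsFiniteMeasure P]
    (X : LOne P) : DecreasesTo (excess X) 0 := by
  refine ⟨antitone_nat_of_succ_le fun n => ?_, ?_, fun b hb => ?_⟩
  · rw [← Lp.coeFn_le]
    filter_upwards [coeFn_excess X n, coeFn_excess X (n + 1)] with ω h1 h2
    rw [h1, h2]
    exact max_le_max_right _ (by push_cast; linarith)
  · rintro _ ⟨n, rfl⟩
    exact excess_nonneg X n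
  · rw [← Lp.coeFn_le]
    have h1 : ∀ᵐ ω ∂P, ∀ n, b ω ≤ excess X n ω :=
      ae_all_iff.2 fun n => (Lp.coeFn_le _ _).2 (hb ⟨n, rfl⟩)
    filter_upwards [h1, ae_all_iff.2 (coeFn_excess X), Lp.coeFn_zero ℝ 1 P] with ω h1 h2 h3
    obtain ⟨n, hn⟩ := exists_nat_ge |X ω|
    rw [h3]
    refine (h1 n).trans ?_
    rw [h2, max_eq_right (by linarith)]
    rfl

/-! ### Locality and linear minorants -/

/-- The product of `X` with the indicator function of `A`. -/
noncomputable def restrictTo {Ω : Type*} [MeasurableSpace Ω] {P : Measure Ω} {A : Set Ω}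
    (hA : MeasurableSet A) (X : LOne P) : LOne P :=
  ((Lp.memLp X).indicator hA).toLp (A.indicator X)

theorem coeFn_restrictTo {Ω : Type*} [MeasurableSpace Ω] {P : Measure Ω} {A : Set Ω}
    (hA : MeasurableSet A) (X : LOne P) : restrictTo hA X =ᵐ[P] A.indicator X :=
  MemLp.coeFn_toLp _

section Conditional

variable {Ω : Type*} {G F : MeasurableSpace Ω} {P : Measure Ω} {h : LOne P → LOneSub G P}

theorem IsSublinear.map_zero (h_subl : IsSublinear h) : h 0 = 0 := by
  simpa using h_subl.2 0 0 le_rfl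

theorem integrable_coeFn_map (h : LOne P → LOneSub G P) (X : LOne P) :
    Integrable (h X : LOne P) P :=
  L1.integrable_coeFn _

theorem coeFn_map_mono (h_mono : Monotone h) {X Y : LOne P} (hXY : X ≤ Y) :
    (h X : LOne P) ≤ᵐ[P] (h Y : LOne P) :=
  (Lp.coeFn_le _ _).2 (h_mono hXY)

theorem coeFn_map_add_le (h_subl : IsSublinear h) (X Y : LOne P) :
    ∀ᵐ ω ∂P, (h (X + Y) : LOne P) ω ≤ (h X : LOne P) ω + (h Y : LOne P) ω := by
  have h1 : (h (X + Y) : LOne P) ≤ (h X : LOne P) + (h Y : LOne P) := h_subl.1 X Y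
  rw [← Lp.coeFn_le] at h1
  filter_upwards [h1, Lp.coeFn_add (h X : LOne P) (h Y : LOne P)] with ω h1 h2
  rwa [h2] at h1

theorem coeFn_map_nonneg (h_mono : Monotone h) (h_subl : IsSublinear h) {X : LOne P}
    (hX : 0 ≤ X) : 0 ≤ᵐ[P] (h X : LOne P) := by
  have h1 : (0 : LOneSub G P) ≤ h X := h_subl.map_zero ▸ h_mono hX
  exact (Lp.coeFn_nonneg _).2 h1

open Filter Topology in
/-- If `X` vanishes off `A ∈ 𝓖`, then `h X ≤ 0` off `A`, in the mean. -/
theorem setIntegral_compl_map_restrictTo_nonpos [IsFiniteMeasure P] (hG : G ≤ F)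
    (h_mono : Monotone h) (h_subl : IsSublinear h) (h_norm : IsNormalizedOn (LOneSub G P) h)
    (h_cont : ContinuousFromAbove h) {A : Set Ω} (hA : MeasurableSet[G] A) (X : LOne P) :
    ∫ ω in Aᶜ, (h (restrictTo (hG A hA) X) : LOne P) ω ∂P ≤ 0 := by
  have hlim : Tendsto (fun n => ∫ ω, (h (excess X n) : LOne P) ω ∂P) atTop (𝓝 0) :=
    tendsto_integral_of_decreasesTo_zero
      (h_subl.map_zero ▸ h_cont _ _ _ (abs_excess_le X) (decreasesTo_excess X))
  refine ge_of_tendsto' hlim fun n => ?_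
  let K : LOneSub G P := ⟨indicatorConstLp 1 (hG A hA) (measure_ne_top P A) (n : ℝ),
    mem_lpMeas_indicatorConstLp hG hA (measure_ne_top P A)⟩
  have hK : (K : LOne P) =ᵐ[P] A.indicator fun _ => (n : ℝ) :=
    indicatorConstLp_coeFn (hs := hG A hA) (hμs := measure_ne_top P A)
  -- `h` fixes `n 1_A`, which vanishes off `A`; there only `h` of the excess is left, and its mean
  -- tends to `0`.
  have hle : restrictTo (hG A hA) X ≤ K + excess X n := by
    rw [← Lp.coeFn_le]
    filter_upwards [coeFn_restrictTo (hG A hA) X, Lp.coeFn_add (K : LOne P) (excess X n), hK,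
      coeFn_excess X n] with ω h1 h2 h3 h4
    rw [h1, h2, Pi.add_apply, h3, h4]
    by_cases hω : ω ∈ A
    · simp only [hω, Set.indicator_of_mem]
      linarith [le_max_left (|X ω| - n) 0, le_abs_self (X ω)]
    · simp [hω]
  have hE := coeFn_map_nonneg h_mono h_subl (excess_nonneg X n)
  calc ∫ ω in Aᶜ, (h (restrictTo (hG A hA) X) : LOne P) ω ∂P
      ≤ ∫ ω in Aᶜ, (h (excess X n) : LOne P) ω ∂P := by
        refine setIntegral_mono_on_ae (integrable_coeFn_map h _).integrableOn
          (integrable_coeFn_map h _).integrableOn (hG A hA).compl ?_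
        filter_upwards [coeFn_map_mono h_mono hle, coeFn_map_add_le h_subl (K : LOne P)
          (excess X n), hK] with ω h1 h2 h3 hω
        rw [h_norm K, h3, Set.indicator_of_notMem hω, zero_add] at h2
        exact h1.trans h2
    _ ≤ ∫ ω, (h (excess X n) : LOne P) ω ∂P :=
        setIntegral_le_integral (integrable_coeFn_map h _) hE

/-- Locality of `h`, in the mean. -/
theorem integral_map_restrictTo_le [IsFiniteMeasure P] (hG : G ≤ F)
    (h_mono : Monotone h) (h_subl : IsSublinear h) (h_norm : IsNormalizedOn (LOneSub G P) h)
    (h_cont : ContinuousFromAbove h) {A : Set Ω} (hA : MeasurableSet[G] A) (X : LOne P) :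
    ∫ ω, (h (restrictTo (hG A hA) X) : LOne P) ω ∂P ≤ ∫ ω in A, (h X : LOne P) ω ∂P := by
  have hA' := hG A hA
  have h1 := setIntegral_compl_map_restrictTo_nonpos hG h_mono h_subl h_norm h_cont hA X
  have h2 := setIntegral_compl_map_restrictTo_nonpos hG h_mono h_subl h_norm h_cont hA.compl (-X)
  rw [compl_compl] at h2
  -- By subadditivity, the error on `A` is `h (1_{Aᶜ} (-X))`, whose integral over `A` is nonpositive
  -- by `h2`.
  have hsub : restrictTo hA' X = X + restrictTo hA'.compl (-X) := by
    ext
    filter_upwards [coeFn_restrictTo hA' X, coeFn_restrictTo hA'.compl (-X), Lp.coeFn_neg X,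
      Lp.coeFn_add X (restrictTo hA'.compl (-X))] with ω h1 h2 h3 h4
    rw [h1, h4, Pi.add_apply, h2]
    by_cases hω : ω ∈ A
    · simp [hω]
    · rw [Set.indicator_of_notMem hω, Set.indicator_of_mem (Set.mem_compl hω), h3, Pi.neg_apply,
        add_neg_cancel]
  have h3 : ∫ ω in A, (h (restrictTo hA' X) : LOne P) ω ∂P
      ≤ ∫ ω in A, (h X : LOne P) ω + (h (restrictTo hA'.compl (-X)) : LOne P) ω ∂P := by
    refine setIntegral_mono_on_ae (integrable_coeFn_map h _).integrableOn
      ((integrable_coeFn_map h _).add (integrable_coeFn_map h _)).integrableOn hA' ?_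
    filter_upwards [coeFn_map_add_le h_subl X (restrictTo hA'.compl (-X))] with ω h4 _
    rw [hsub]
    exact h4
  rw [integral_add (integrable_coeFn_map h _).integrableOn
    (integrable_coeFn_map h _).integrableOn] at h3
  rw [← integral_add_compl hA' (integrable_coeFn_map h _)]
  linarith

/-- The integral of `h` as a sublinear functional has linear minorants touching it anywhere. -/
theorem exists_linear_le_integral_map (h_subl : IsSublinear h) (X₀ : LOne P) :
    ∃ l : LOne P →ₗ[ℝ] ℝ, l X₀ = ∫ ω, (h X₀ : LOne P) ω ∂P ∧
      ∀ X, l X ≤ ∫ ω, (h X : LOne P) ω ∂P := by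
  let N : LOne P → ℝ := fun X => ∫ ω, (h X : LOne P) ω ∂P
  have N_hom : ∀ c : ℝ, 0 ≤ c → ∀ X, N (c • X) = c * N X := fun c hc X => by
    simp only [N]
    rw [h_subl.2 c X hc, ← integral_const_mul]
    exact integral_congr_ae (Lp.coeFn_smul c (h X : LOne P))
  have N_add : ∀ X Y, N (X + Y) ≤ N X + N Y := fun X Y => by
    simp only [N]
    rw [← integral_add (integrable_coeFn_map h _) (integrable_coeFn_map h _)]
    exact integral_mono_ae (integrable_coeFn_map h _)
      ((integrable_coeFn_map h _).add (integrable_coeFn_map h _)) (coeFn_map_add_le h_subl X Y)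
  have N_zero : N 0 = 0 := by simpa using N_hom 0 le_rfl 0
  have H : ∀ c : ℝ, c • X₀ = 0 → (RingHom.id ℝ) c • N X₀ = 0 := fun c hc => by
    rcases smul_eq_zero.1 hc with rfl | h0
    · simp
    · simp [h0, N_zero]
  obtain ⟨g, hg, hgN⟩ := exists_extension_of_le_sublinear
    (LinearPMap.mkSpanSingleton' X₀ (N X₀) H) N (fun c hc X => N_hom c hc.le X) N_add (by
      rintro ⟨x, hx⟩
      obtain ⟨c, rfl⟩ := Submodule.mem_span_singleton.1 hx
      rw [LinearPMap.mkSpanSingleton'_apply]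
      simp only [RingHom.id_apply, smul_eq_mul]
      rcases le_total 0 c with hc | hc
      · exact (N_hom c hc X₀).ge
      -- For `c ≤ 0`, use `0 = N 0 ≤ N (c • X₀) + N (-c • X₀)`.
      · have h1 := N_hom (-c) (by linarith) X₀
        have h2 := N_add (c • X₀) (-c • X₀)
        rw [← add_smul, add_neg_cancel, zero_smul, N_zero, h1] at h2
        linarith)
  refine ⟨g, ?_, hgN⟩
  exact (hg ⟨X₀, Submodule.mem_span_singleton_self X₀⟩).trans
    (LinearPMap.mkSpanSingleton'_apply_self X₀ (N X₀) H _)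

end Conditional

/-! ### The representing measures -/

/-- The measures `Q` that agree with `P` on `𝓖` and whose conditional expectations given `𝓖` are
dominated by `h`, in integrated form. -/
def dominatedMeasures {Ω : Type*} {G F : MeasurableSpace Ω} (hG : G ≤ F) (P : Measure Ω)
    (h : LOne P → LOneSub G P) : Set (Measure Ω) :=
  {Q | Q ∈ probAgreeing hG P ∧ ∀ X : LOne P, Integrable X Q ∧
    ∀ A, MeasurableSet[G] A → ∫ ω in A, X ω ∂Q ≤ ∫ ω in A, (h X : LOne P) ω ∂P}

section Representation

variable {Ω : Type*} {G F : MeasurableSpace Ω} {hG : G ≤ F} {P : Measure Ω}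
  {h : LOne P → LOneSub G P}

theorem convex_probAgreeing : Convex ℝ≥0 (probAgreeing hG P) := by
  rintro Q₁ ⟨h₁, hac₁, ht₁⟩ Q₂ ⟨h₂, hac₂, ht₂⟩ a b - - hab
  have hab' : (a : ℝ≥0∞) + b = 1 := by exact_mod_cast hab
  refine ⟨⟨?_⟩, ?_, ?_⟩
  · rw [Measure.add_apply, Measure.smul_apply, Measure.smul_apply, measure_univ, measure_univ,
      ENNReal.smul_def, ENNReal.smul_def, smul_eq_mul, smul_eq_mul, mul_one, mul_one, hab']
  · refine Measure.AbsolutelyContinuous.mk fun s _ hs => ?_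
    simp [hac₁ hs, hac₂ hs]
  · refine @Measure.ext _ G _ _ fun s hs => ?_
    have e₁ : Q₁ s = P s := by rw [← trim_measurableSet_eq hG hs, ht₁, trim_measurableSet_eq hG hs]
    have e₂ : Q₂ s = P s := by rw [← trim_measurableSet_eq hG hs, ht₂, trim_measurableSet_eq hG hs]
    rw [trim_measurableSet_eq hG hs, trim_measurableSet_eq hG hs]
    simp only [Measure.add_apply, Measure.smul_apply, e₁, e₂, ENNReal.smul_def, smul_eq_mul]
    rw [← add_mul, hab', one_mul]

theorem convex_dominatedMeasures : Convex ℝ≥0 (dominatedMeasures hG P h) := by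
  rintro Q₁ ⟨h₁, hd₁⟩ Q₂ ⟨h₂, hd₂⟩ a b ha hb hab
  refine ⟨convex_probAgreeing h₁ h₂ ha hb hab, fun X => ?_⟩
  have i₁ : Integrable X (a • Q₁) := (hd₁ X).1.smul_measure_nnreal
  have i₂ : Integrable X (b • Q₂) := (hd₂ X).1.smul_measure_nnreal
  refine ⟨i₁.add_measure i₂, fun A hA => ?_⟩
  have hab' : (a : ℝ) + b = 1 := by exact_mod_cast hab
  rw [Measure.restrict_add, integral_add_measure i₁.restrict i₂.restrict, Measure.restrict_smul,
    Measure.restrict_smul, integral_smul_nnreal_measure, integral_smul_nnreal_measure]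
  calc a • ∫ ω in A, X ω ∂Q₁ + b • ∫ ω in A, X ω ∂Q₂
      ≤ (a : ℝ) * ∫ ω in A, (h X : LOne P) ω ∂P + (b : ℝ) * ∫ ω in A, (h X : LOne P) ω ∂P :=
        add_le_add (mul_le_mul_of_nonneg_left ((hd₁ X).2 A hA) a.2)
          (mul_le_mul_of_nonneg_left ((hd₂ X).2 A hA) b.2)
    _ = ∫ ω in A, (h X : LOne P) ω ∂P := by rw [← add_mul, hab', one_mul]

/-- The integrand on the left is `𝓖`-measurable, and `P`, `Q` coincide on `𝓖`. -/
theorem setIntegral_condExp_of_mem_probAgreeing {Q : Measure Ω} (hQ : Q ∈ probAgreeing hG P)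
    {X : Ω → ℝ} (hX : Integrable X Q) {A : Set Ω} (hA : MeasurableSet[G] A) :
    ∫ ω in A, (condExp G Q X) ω ∂P = ∫ ω in A, X ω ∂Q := by
  have := hQ.1
  rw [← setIntegral_condExp hG hX hA, setIntegral_trim hG stronglyMeasurable_condExp hA,
    setIntegral_trim hG stronglyMeasurable_condExp hA, hQ.2.2]

theorem coeFn_condExpIn {Q : Measure Ω} (hQ : Q ∈ probAgreeing hG P) (X : Ω → ℝ) :
    (condExpIn hQ X : LOne P) =ᵐ[P] condExp G Q X :=
  (condExp_memLp_of_mem_probAgreeing hQ X).coeFn_toLp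

theorem integral_condExpIn {Q : Measure Ω} (hQ : Q ∈ probAgreeing hG P) {X : Ω → ℝ}
    (hX : Integrable X Q) : ∫ ω, (condExpIn hQ X : LOne P) ω ∂P = ∫ ω, X ω ∂Q := by
  rw [integral_congr_ae (coeFn_condExpIn hQ X)]
  simpa using setIntegral_condExp_of_mem_probAgreeing hQ hX MeasurableSet.univ

theorem condExpIn_le_of_mem_dominatedMeasures {Q : Measure Ω}
    (hQ : Q ∈ dominatedMeasures hG P h) (X : LOne P) : condExpIn hQ.1 X ≤ h X := by
  have hm := lpMeas.aestronglyMeasurable (h X)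
  have hci : Integrable (condExp G Q X) P :=
    memLp_one_iff_integrable.1 (condExp_memLp_of_mem_probAgreeing hQ.1 X)
  have hhi : Integrable (hm.mk _) P := (L1.integrable_coeFn (h X : LOne P)).congr hm.ae_eq_mk
  -- Sets in `𝓖` suffice as tests once both sides are `𝓖`-measurable, hence the trimmed measure and
  -- the representative `hm.mk _`.
  have key : condExp G Q X ≤ᵐ[P.trim hG] hm.mk _ := by
    refine ae_le_of_forall_setIntegral_le (hci.trim hG stronglyMeasurable_condExp)
      (hhi.trim hG hm.stronglyMeasurable_mk) fun A hA _ => ?_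
    rw [← setIntegral_trim hG stronglyMeasurable_condExp hA,
      ← setIntegral_trim hG hm.stronglyMeasurable_mk hA,
      setIntegral_condExp_of_mem_probAgreeing hQ.1 (hQ.2 X).1 hA,
      ← setIntegral_congr_ae (hG A hA) (hm.ae_eq_mk.mono fun ω hω _ => hω)]
    exact (hQ.2 X).2 A hA
  change (condExpIn hQ.1 X : LOne P) ≤ (h X : LOne P)
  rw [← Lp.coeFn_le]
  filter_upwards [coeFn_condExpIn hQ.1 X, ae_le_of_ae_le_trim key, hm.ae_eq_mk] with ω h1 h2 h3
  rw [h1, h3]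
  exact h2

theorem exists_mem_dominatedMeasures_integral_eq [IsProbabilityMeasure P]
    (h_mono : Monotone h) (h_subl : IsSublinear h) (h_norm : IsNormalizedOn (LOneSub G P) h)
    (h_cont : ContinuousFromAbove h) (X₀ : LOne P) :
    ∃ Q ∈ dominatedMeasures hG P h, ∫ ω, X₀ ω ∂Q = ∫ ω, (h X₀ : LOne P) ω ∂P := by
  obtain ⟨l, hl₀, hl⟩ := exists_linear_le_integral_map h_subl X₀
  have hpos : ∀ X, 0 ≤ X → 0 ≤ l X := fun X hX => by
    have h1 : ∫ ω, (h (-X) : LOne P) ω ∂P ≤ 0 := by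
      have h2 : h (-X) ≤ 0 := h_subl.map_zero ▸ h_mono (neg_nonpos.2 hX)
      have h3 : (h (-X) : LOne P) ≤ 0 := h2
      rw [← Lp.coeFn_le] at h3
      exact integral_nonpos_of_ae (h3.trans_eq (Lp.coeFn_zero ℝ 1 P))
    have := hl (-X)
    rw [map_neg] at this
    linarith
  obtain ⟨Q, C, hC, hQP, hQ⟩ := exists_measure_integral_eq P l hpos
  have hac : Q ≪ P := Measure.absolutelyContinuous_of_le_smul hQP
  have hint : ∀ X : LOne P, Integrable X Q := fun X =>
    (L1.integrable_coeFn X).of_measure_le_smul hC hQP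
  have : IsFiniteMeasure Q :=
    ⟨(hQP Set.univ).trans_lt (by simpa using hC.lt_top)⟩
  have hset : ∀ (A : Set Ω) (hA : MeasurableSet A) (X : LOne P),
      ∫ ω in A, X ω ∂Q = l (restrictTo hA X) := fun A hA X => by
    rw [← hQ, integral_congr_ae (hac.ae_eq (coeFn_restrictTo hA X)), integral_indicator hA]
  -- Applying `l ≤ E^P[h ·]` to both `Z` and `-Z` turns the bound into equality.
  have hnorm : ∀ Z : LOneSub G P, l Z = ∫ ω, (Z : LOne P) ω ∂P := fun Z => by
    have h1 := hl Z
    have h2 := hl ((-Z : LOneSub G P) : LOne P)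
    rw [h_norm] at h1 h2
    have h3 : ∫ ω, ((-Z : LOneSub G P) : LOne P) ω ∂P = -∫ ω, (Z : LOne P) ω ∂P := by
      rw [← integral_neg]
      exact integral_congr_ae (Lp.coeFn_neg (Z : LOne P))
    rw [h3, Submodule.coe_neg, map_neg] at h2
    linarith
  have hagree : ∀ A, MeasurableSet[G] A → Q A = P A := fun A hA => by
    let K : LOneSub G P := ⟨indicatorConstLp 1 (hG A hA) (measure_ne_top P A) (1 : ℝ),
      mem_lpMeas_indicatorConstLp hG hA (measure_ne_top P A)⟩
    have hK : (K : LOne P) =ᵐ[P] A.indicator fun _ => (1 : ℝ) :=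
      indicatorConstLp_coeFn (hs := hG A hA) (hμs := measure_ne_top P A)
    have h1 := hnorm K
    rw [← hQ, integral_congr_ae (hac.ae_eq hK), integral_congr_ae hK,
      integral_indicator_const _ (hG A hA), integral_indicator_const _ (hG A hA)] at h1
    simpa [measureReal_def, ENNReal.toReal_eq_toReal_iff'] using h1
  refine ⟨Q, ⟨⟨⟨?_⟩, hac, ?_⟩, fun X => ⟨hint X, fun A hA => ?_⟩⟩, (hQ X₀).trans hl₀⟩
  · rw [hagree _ .univ, measure_univ]
  · refine @Measure.ext _ G _ _ fun A hA => ?_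
    rw [trim_measurableSet_eq hG hA, trim_measurableSet_eq hG hA, hagree A hA]
  · rw [hset A (hG A hA)]
    exact (hl _).trans
      (integral_map_restrictTo_le hG h_mono h_subl h_norm h_cont hA X)

end Representation

theorem mainTheorem4 {Ω : Type*} {G F : MeasurableSpace Ω} (hG : G ≤ F)
    (P : Measure Ω) [IsProbabilityMeasure P]
    (h : LOne P → LOneSub G P)
    (h_mono : Monotone h) (h_subl : IsSublinear h)
    (h_norm : IsNormalizedOn (LOneSub G P) h) (h_cont : ContinuousFromAbove h) :
    ∃ (𝒬 : Set (Measure Ω)) (h𝒬 : 𝒬 ⊆ probAgreeing hG P),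
      Convex ℝ≥0 𝒬 ∧
      ∀ X : LOne P,
        (∀ Q ∈ 𝒬, Integrable X Q) ∧
        IsLUB (Set.range fun Q : 𝒬 => condExpIn (h𝒬 Q.2) X) (h X) := by
  refine ⟨dominatedMeasures hG P h, fun Q hQ => hQ.1, convex_dominatedMeasures, fun X =>
    ⟨fun Q hQ => (hQ.2 X).1, IsGreatest.isLUB ⟨?_, ?_⟩⟩⟩
  · obtain ⟨Q, hQ, heq⟩ := exists_mem_dominatedMeasures_integral_eq (hG := hG)
      h_mono h_subl h_norm h_cont X
    refine ⟨⟨Q, hQ⟩, Subtype.ext (Lp.ext ?_)⟩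
    have hle : (condExpIn hQ.1 X : LOne P) ≤ᵐ[P] (h X : LOne P) :=
      (Lp.coeFn_le _ _).2 (condExpIn_le_of_mem_dominatedMeasures hQ X)
    -- An a.s. inequality between functions with equal integrals is an a.s. equality.
    refine (integral_eq_iff_of_ae_le (L1.integrable_coeFn _) (L1.integrable_coeFn _) hle).1 ?_
    exact (integral_condExpIn hQ.1 (hQ.2 X).1).trans heq
  · rintro _ ⟨Q, rfl⟩
    exact condExpIn_le_of_mem_dominatedMeasures Q.2 X
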